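/- **Theorem (Sharp moment upper bound).** Let $d\ge 1$ and let $[X_{n,i}:1\le i\le n,\ n\ge1]$ be a triangular array of $\mathbb R^d$-valued random variables on a common probability space $(\Omega,\mathcal F,\mathrm P)$, all with the same marginal law $\mu$. For $m\ge 1$ let $$\alpha_m:=\sup_{n\ge1}\ \sup_{1\le k\le n-m}\ \sup\big\{|\mathrm P(A\cap B)-\mathrm P(A)\mathrm P(B)|: A\in\sigma(X_{n,i}:1\le i\le k),\ B\in\sigma(X_{n,i}:k+m\le i\le n)\big\}.$$ For $x\in\mathbb R^d$ and $1\le k\le n$ let $R_{n,k}(x)$ be the Euclidean distance from $x$ to its $k$-th nearest neighbor among $X_{n,1},\dots,X_{n,n}$ (ties broken arbitrarily), and let $B(x,r)$ be the closed Euclidean ball. Assume, for a fixed point $x$ and constants $\gamma,s,c_-,r_0>0$ and $D$: 1. (geometric $\alpha$-mixing) $\alpha_m\le e^{-\gamma m}$ for all $m\ge1$; 2. (local lower mass of order $s$ at $x$) $\mu(B(x,r))\ge c_-r^s$ for all $0<r\le r_0$; 3. (compact support) the support of $\mu$ is contained in a compact set of diameter at most $D$. Let $p>0$, $K_0>0$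 and $0<\kappa<c_-r_0^s/8$. Then there is a constant $C_{p,s}>0$, depending only on $p,s,c_-,r_0,\gamma,D,K_0$, such that for all integers $1\le k\le n$ with $K_0\log n\le k\le\kappa n$, the variable $R_{n,k}(x)^p$ is integrable and $$\mathrm E\big[R_{n,k}(x)^p\big]\le C_{p,s}\Big(\frac kn\Big)^{p/s}.$$ -/

import Mathlib

open MeasureTheory

namespace MixingKNN

/-- `ℝᵈ` with the Euclidean norm. -/
abbrev E (d : ℕ) : Type := EuclideanSpace ℝ (Fin d)

/-- The σ-field generated by the observations number `a, …, b` (numbered from `1`) of one row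
`Y = (Y₁, …, Yₙ)`; the entry with index `i : Fin n` is the observation number `i + 1`. -/
@[reducible]
def segmentSigma {Ω : Type*} {d n : ℕ} (Y : Fin n → Ω → E d) (a b : ℕ) : MeasurableSpace Ω :=
  ⨆ i : Fin n, ⨆ _ : a ≤ (i : ℕ) + 1 ∧ (i : ℕ) + 1 ≤ b,
    MeasurableSpace.comap (Y i) inferInstance

/-- The strong mixing coefficient `α_m` of the triangular array `X`: the supremum of
`|P(A ∩ B) - P(A) P(B)|` over all rows `n`, all `1 ≤ k ≤ n - m`, all events `A` of the
observations `1, …, k` and all events `B` of the observations `k + m, …, n` of row `n`. -/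
noncomputable def alphaCoeff {Ω : Type*} [MeasurableSpace Ω] (P : Measure Ω) {d : ℕ}
    (X : (n : ℕ) → Fin n → Ω → E d) (m : ℕ) : ℝ :=
  sSup {t : ℝ | ∃ n k : ℕ, 1 ≤ k ∧ k + m ≤ n ∧ ∃ A B : Set Ω,
    MeasurableSet[segmentSigma (X n) 1 k] A ∧ MeasurableSet[segmentSigma (X n) (k + m) n] B ∧
    t = |P.real (A ∩ B) - P.real A * P.real B|}

/-- Geometric α-mixing with rate `γ`. -/
def GeometricMixing {Ω : Type*} [MeasurableSpace Ω] (P : Measure Ω) {d : ℕ}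
    (X : (n : ℕ) → Fin n → Ω → E d) (γ : ℝ) : Prop :=
  ∀ m : ℕ, 1 ≤ m → alphaCoeff P X m ≤ Real.exp (-γ * m)

/-- Local lower mass of order `s` at `x`, with constants `c` and `r₀`. -/
def LocalLowerMass {d : ℕ} (μ : Measure (E d)) (x : E d) (s c r₀ : ℝ) : Prop :=
  ∀ r : ℝ, 0 < r → r ≤ r₀ → c * r ^ s ≤ μ.real (Metric.closedBall x r)

/-- The support of `μ` is contained in a compact set of diameter at most `D`. -/
def CompactSupport {d : ℕ} (μ : Measure (E d)) (D : ℝ) : Prop :=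
  ∃ K : Set (E d), IsCompact K ∧ Metric.diam K ≤ D ∧ μ.support ⊆ K

/-- The `k`-th nearest neighbor of `x` among the points `y₁, …, yₙ`, for `1 ≤ k ≤ n`: the `k`-th
point after sorting by the distance to `x`. Ties are broken by the index. -/
noncomputable def kthNeighbor {d n : ℕ} (x : E d) (y : Fin n → E d) (k : ℕ) (hk : 1 ≤ k ∧ k ≤ n) : E d :=
  y (Tuple.sort (fun i => ‖y i - x‖) ⟨k - 1, by omega⟩)

/-- The `k`-nearest-neighbor radius of `x` among the points `y₁, …, yₙ`. -/
noncomputable def radius {d n : ℕ} (x : E d) (y : Fin n → E d) (k : ℕ)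
    (hk : 1 ≤ k ∧ k ≤ n) : ℝ :=
  ‖kthNeighbor x y k hk - x‖

/-- The radius does not depend on how ties are broken: every ordering `σ` of the points by
nondecreasing distance to `x` gives the same value. -/
theorem radius_eq {d n : ℕ} (x : E d) (y : Fin n → E d) (k : ℕ) (hk : 1 ≤ k ∧ k ≤ n)
    (σ : Equiv.Perm (Fin n)) (hσ : Monotone fun i => ‖y (σ i) - x‖) :
    radius x y k hk = ‖y (σ ⟨k - 1, by omega⟩) - x‖ := by
  have h := Tuple.unique_monotone (f := fun i => ‖y i - x‖)
    (Tuple.monotone_sort (fun i => ‖y i - x‖)) hσ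
  exact congrFun h ⟨k - 1, by omega⟩

end MixingKNN

/-!
The event `R > t` for the `k`-th nearest-neighbor radius `R` says that fewer than `k` observations
lie in the closed ball `B(x, t)`. Split the indices into `b = A * k` residue classes modulo `b`,
with an integer `A ≥ 2`. Each observation in the ball meets a single class, so on this event at
least half of the classes avoid the ball (`le_two_mul_card_filter_forall_notMem`), and by Markov's
inequality `P(R > t)` is at most twice the largest probability that a single class avoids it.

Inside one class the indices are `b` apart, so applying the mixing condition once per index, always
to the event of the past and to the next observation, bounds this probability by
`(1 - m) ^ q + q * exp (-γ * b)`, where `m = μ (B(x, t))` and `q = n / b` is the number of indices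
used (`GeometricMixing.measureReal_forall_notMem_le`). With `m ≥ c * t ^ s` the first term is at
most `exp (-β * t ^ s)` for some `β` of order `n / k`. As `b ≥ A * K₀ * log n`, the second term is
at most `n ^ (-p / s)` once `γ * A * K₀ ≥ 1 + p / s`.

Integrating this tail against `p * t ^ (p - 1)` gives a Gamma integral of order
`β ^ (-p / s)`, that is, of order `(k / n) ^ (p / s)`, and the error `n ^ (-p / s)` is multiplied
only by a constant because `R` is almost surely bounded by the diameter of the support, `x` itself
being in the support. When `A * k > n`, the ratio `k / n` is bounded below and this boundedness
alone suffices.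
-/

namespace MixingKNN

/-! ### Mixing for events of the array -/

lemma measurableSet_segmentSigma_preimage {Ω : Type*} {d n : ℕ} {Y : Fin n → Ω → E d} {a b : ℕ}
    (i : Fin n) (ha : a ≤ (i : ℕ) + 1) (hb : (i : ℕ) + 1 ≤ b) {S : Set (E d)} (hS : MeasurableSet S) :
    MeasurableSet[segmentSigma Y a b] (Y i ⁻¹' S) := by
  have h : MeasurableSpace.comap (Y i) inferInstance ≤ segmentSigma Y a b :=
    le_iSup₂_of_le (f := fun (i : Fin n) (_ : a ≤ (i : ℕ) + 1 ∧ (i : ℕ) + 1 ≤ b) =>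
      MeasurableSpace.comap (Y i) inferInstance) i ⟨ha, hb⟩ le_rfl
  exact h _ ⟨S, hS, rfl⟩

section Mixing

variable {Ω : Type*} [MeasurableSpace Ω] {P : Measure Ω} [IsProbabilityMeasure P] {d : ℕ}
  {X : (n : ℕ) → Fin n → Ω → E d} {γ : ℝ}

lemma GeometricMixing.measureReal_inter_le (h : GeometricMixing P X γ) {n k m : ℕ} (hk : 1 ≤ k)
    (hm : 1 ≤ m) (hkm : k + m ≤ n) {A B : Set Ω} (hA : MeasurableSet[segmentSigma (X n) 1 k] A)
    (hB : MeasurableSet[segmentSigma (X n) (k + m) n] B) :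
    P.real (A ∩ B) ≤ P.real A * P.real B + Real.exp (-γ * m) := by
  have hbdd : BddAbove {t : ℝ | ∃ n k : ℕ, 1 ≤ k ∧ k + m ≤ n ∧ ∃ A B : Set Ω,
      MeasurableSet[segmentSigma (X n) 1 k] A ∧ MeasurableSet[segmentSigma (X n) (k + m) n] B ∧
      t = |P.real (A ∩ B) - P.real A * P.real B|} := by
    refine ⟨1, ?_⟩
    rintro _ ⟨n, k, -, -, A, B, -, -, rfl⟩
    have h0 : 0 ≤ P.real A * P.real B := by positivity
    have h1 : P.real A * P.real B ≤ 1 :=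
      mul_le_one₀ measureReal_le_one measureReal_nonneg measureReal_le_one
    have h2 : 0 ≤ P.real (A ∩ B) := measureReal_nonneg
    have h3 : P.real (A ∩ B) ≤ 1 := measureReal_le_one
    rw [abs_le]
    constructor <;> linarith
  have h1 := (le_csSup hbdd ⟨n, k, hk, hkm, A, B, hA, hB, rfl⟩).trans (h m hm)
  linarith [le_abs_self (P.real (A ∩ B) - P.real A * P.real B)]

/-- Observations whose indices are at least `b` apart avoid a set `S` of mass `m` with almost the
probability `(1 - m) ^ q` of the independent case: splitting off the last index costs one mixing
coefficient. -/
lemma GeometricMixing.measureReal_forall_notMem_le (h : GeometricMixing P X γ)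
    (hX : ∀ n i, Measurable (X n i)) {n b : ℕ} (hb : 1 ≤ b) {S : Set (E d)} (hS : MeasurableSet S)
    {m : ℝ} (hm : ∀ i, P.real (X n i ⁻¹' S) = m) (f : ℕ → Fin n) (q : ℕ)
    (hf : ∀ i j, i < j → j < q → (f i : ℕ) + b ≤ f j) :
    P.real {ω | ∀ j < q, X n (f j) ω ∉ S} ≤ (1 - m) ^ q + q * Real.exp (-γ * b) := by
  induction q with
  | zero => simp
  | succ q ih =>
    have hmem (i : Fin n) : P.real (X n i ⁻¹' Sᶜ) = 1 - m := by
      rw [Set.preimage_compl, probReal_compl_eq_one_sub (hX n i hS), hm]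
    have hm1 : 0 ≤ 1 - m := by
      rw [← hmem (f 0)]
      exact measureReal_nonneg
    have hm1' : 1 - m ≤ 1 := by
      rw [← hmem (f 0)]
      exact measureReal_le_one
    have hsplit : {ω | ∀ j < q + 1, X n (f j) ω ∉ S}
        = {ω | ∀ j < q, X n (f j) ω ∉ S} ∩ X n (f q) ⁻¹' Sᶜ := by
      ext ω
      simp only [Set.mem_ofPred_eq, Set.mem_inter_iff, Set.mem_preimage, Set.mem_compl_iff,
        Nat.lt_succ_iff_lt_or_eq]
      constructor
      · exact fun H => ⟨fun j hj => H j (.inl hj), H q (.inr rfl)⟩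
      · rintro ⟨H, H'⟩ j (hj | rfl)
        exacts [H j hj, H']
    have ih := ih fun i j hij hj => hf i j hij (hj.trans q.lt_succ_self)
    have he : 0 ≤ Real.exp (-γ * b) := (Real.exp_pos _).le
    rcases Nat.eq_zero_or_pos q with rfl | hq
    · rw [hsplit]
      simp only [not_lt_zero, IsEmpty.forall_iff, implies_true, Set.ofPred_true, Set.univ_inter,
        hmem]
      simpa using he
    have hlast := (f q).isLt
    have hgap := hf (q - 1) q (by omega) q.lt_succ_self
    have hA : MeasurableSet[segmentSigma (X n) 1 ((f (q - 1) : ℕ) + 1)]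
        {ω | ∀ j < q, X n (f j) ω ∉ S} := by
      have hInter : {ω | ∀ j < q, X n (f j) ω ∉ S}
          = ⋂ j, ⋂ (_ : j < q), X n (f j) ⁻¹' Sᶜ := by
        ext ω
        simp
      rw [hInter]
      refine MeasurableSet.iInter fun j => MeasurableSet.iInter fun hj => ?_
      refine measurableSet_segmentSigma_preimage _ (by omega) ?_ hS.compl
      rcases (Nat.le_sub_one_of_lt hj).eq_or_lt with rfl | hj'
      · rfl
      · have := hf j (q - 1) hj' (by omega)
        omega
    have hmix := h.measureReal_inter_le (Nat.le_add_left 1 (f (q - 1) : ℕ)) hb (by omega) hA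
      (measurableSet_segmentSigma_preimage (Y := X n) (b := n) (f q) (by omega) hlast hS.compl)
    rw [hsplit]
    refine hmix.trans ?_
    rw [hmem]
    have h1 := mul_le_mul_of_nonneg_right ih hm1
    have h2 : (q : ℝ) * Real.exp (-γ * b) * (1 - m) ≤ q * Real.exp (-γ * b) :=
      mul_le_of_le_one_right (by positivity) hm1'
    push_cast
    rw [pow_succ]
    linarith

end Mixing

/-! ### Counting points by residue classes -/

/-- If fewer than `k ≤ b / 2` of the points lie in `S`, then at least half of the residue classes
modulo `b` contain no index of a point in `S`. The classes are truncated to `q` indices each. -/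
lemma le_two_mul_card_filter_forall_notMem {α : Type*} {n b q k : ℕ} (hk : 2 * k ≤ b)
    (y : Fin n → α) (S : Set α) [DecidablePred (· ∈ S)]
    (hy : (Finset.univ.filter fun i => y i ∈ S).card < k) (f : ℕ → ℕ → Fin n)
    (hf : ∀ a < b, ∀ j < q, (f a j : ℕ) = a + j * b) :
    b ≤ 2 * ((Finset.range b).filter fun a => ∀ j < q, y (f a j) ∉ S).card := by
  have hsum := Finset.card_filter_add_card_filter_not (s := Finset.range b)
    (fun a => ∀ j < q, y (f a j) ∉ S)
  have himage : ((Finset.range b).filter fun a => ¬ ∀ j < q, y (f a j) ∉ S) ⊆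
      (Finset.univ.filter fun i => y i ∈ S).image fun i : Fin n => (i : ℕ) % b := by
    intro a ha
    simp only [Finset.mem_filter, Finset.mem_range, not_forall, not_not] at ha
    obtain ⟨hab, j, hj, hmem⟩ := ha
    refine Finset.mem_image.2 ⟨f a j, by simpa using hmem, ?_⟩
    rw [hf a hab j hj, Nat.add_mul_mod_self_right, Nat.mod_eq_of_lt hab]
  have hle := (Finset.card_le_card himage).trans Finset.card_image_le
  rw [Finset.card_range] at hsum
  omega

/-! ### The nearest-neighbor radius as a counting quantity -/

lemma radius_le_iff {d n : ℕ} (x : E d) (y : Fin n → E d) (k : ℕ) (hk : 1 ≤ k ∧ k ≤ n) (t : ℝ)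
    [DecidablePred (· ∈ Metric.closedBall x t)] :
    radius x y k hk ≤ t ↔
      k ≤ (Finset.univ.filter fun i => y i ∈ Metric.closedBall x t).card := by
  set g : Fin n → ℝ := fun i => ‖y i - x‖
  have h := Tuple.lt_card_le_iff_apply_le_of_monotone (j := ⟨k - 1, by omega⟩)
    (f := g ∘ Tuple.sort g) (a := t) (Tuple.monotone_sort g)
  have hcard : (Finset.univ.filter fun i => (g ∘ Tuple.sort g) i ≤ t).card
      = (Finset.univ.filter fun i => y i ∈ Metric.closedBall x t).card := by
    rw [← Fintype.card_subtype, ← Fintype.card_subtype]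
    refine Fintype.card_congr ((Tuple.sort g).subtypeEquiv fun i => ?_)
    simp [g, dist_eq_norm]
  change g (Tuple.sort g ⟨k - 1, _⟩) ≤ t ↔ _
  rw [← hcard]
  refine h.symm.trans ?_
  simp only
  omega

lemma radius_nonneg {d n : ℕ} (x : E d) (y : Fin n → E d) (k : ℕ) (hk : 1 ≤ k ∧ k ≤ n) :
    0 ≤ radius x y k hk := norm_nonneg _

lemma measurable_radius {Ω : Type*} [MeasurableSpace Ω] {d n : ℕ} (x : E d)
    {Y : Fin n → Ω → E d} (hY : ∀ i, Measurable (Y i)) (k : ℕ) (hk : 1 ≤ k ∧ k ≤ n) :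
    Measurable fun ω => radius x (fun i => Y i ω) k hk := by
  classical
  refine measurable_of_Iic fun t => ?_
  have : (fun ω => radius x (fun i => Y i ω) k hk) ⁻¹' Set.Iic t
      = {ω | k ≤ ∑ i, (Y i ⁻¹' Metric.closedBall x t).indicator (fun _ => 1) ω} := by
    ext ω
    simp only [Set.mem_preimage, Set.mem_Iic, radius_le_iff, Set.mem_ofPred_eq,
      Set.indicator_apply, Finset.sum_boole, Nat.cast_id]
  rw [this]
  refine measurableSet_le measurable_const (Finset.measurable_sum _ fun i _ => ?_)
  exact measurable_const.indicator (hY i Metric.isClosed_closedBall.measurableSet)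

/-! ### Tail of the number of points in a set -/

/-- The number of observations of row `n` in `S` is rarely below `k`: on that event at least half
of the `b` residue classes of indices avoid `S`, so Markov's inequality for the number of avoiding
classes applies. -/
lemma GeometricMixing.measureReal_card_lt_le {Ω : Type*} [MeasurableSpace Ω] {P : Measure Ω}
    [IsProbabilityMeasure P] {d : ℕ} {X : (n : ℕ) → Fin n → Ω → E d} {γ : ℝ}
    (h : GeometricMixing P X γ) (hX : ∀ n i, Measurable (X n i)) {n b q k : ℕ} (hn : 0 < n)
    (hb : 1 ≤ b) (hk : 2 * k ≤ b) (hbq : q * b ≤ n) {S : Set (E d)} [DecidablePred (· ∈ S)]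
    (hS : MeasurableSet S) {m : ℝ} (hm : ∀ i, P.real (X n i ⁻¹' S) = m) :
    P.real {ω | (Finset.univ.filter fun i => X n i ω ∈ S).card < k}
      ≤ 2 * ((1 - m) ^ q + q * Real.exp (-γ * b)) := by
  -- The truncation only makes `f` total: `a + j * b < n` whenever `a < b` and `j < q`.
  let f : ℕ → ℕ → Fin n := fun a j => ⟨min (a + j * b) (n - 1), by omega⟩
  have hf : ∀ a < b, ∀ j < q, (f a j : ℕ) = a + j * b := by
    intro a ha j hj
    have : (j + 1) * b ≤ q * b := Nat.mul_le_mul_right b hj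
    rw [add_mul, one_mul] at this
    change min (a + j * b) (n - 1) = a + j * b
    omega
  set T := {ω | (Finset.univ.filter fun i => X n i ω ∈ S).card < k}
  set G : ℕ → Set Ω := fun a => {ω | ∀ j < q, X n (f a j) ω ∉ S} with hG_def
  have hG : ∀ a, MeasurableSet (G a) := by
    intro a
    have : G a = ⋂ j, ⋂ (_ : j < q), X n (f a j) ⁻¹' Sᶜ := by
      ext ω
      simp [hG_def]
    rw [this]
    exact MeasurableSet.iInter fun j => MeasurableSet.iInter fun _ => hX n _ hS.compl
  have hGle : ∀ a ∈ Finset.range b, P.real (G a) ≤ (1 - m) ^ q + q * Real.exp (-γ * b) := by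
    intro a ha
    rw [Finset.mem_range] at ha
    refine h.measureReal_forall_notMem_le hX hb hS hm (f a) q fun i j hij hj => ?_
    rw [hf a ha i (hij.trans hj), hf a ha j hj]
    have : (i + 1) * b ≤ j * b := Nat.mul_le_mul_right b hij
    rw [add_mul, one_mul] at this
    omega
  have hbpos : (0 : ℝ) < b := by exact_mod_cast hb
  classical
  have hint : ∀ a ∈ Finset.range b, Integrable ((G a).indicator fun _ => (1 : ℝ)) P :=
    fun a _ => (integrable_const _).indicator (hG a)
  have hsub : T ⊆
      {ω | (b : ℝ) / 2 ≤ ∑ a ∈ Finset.range b, (G a).indicator (fun _ => (1 : ℝ)) ω} := by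
    intro ω hω
    have h1 := le_two_mul_card_filter_forall_notMem hk (fun i => X n i ω) S hω f hf
    have h2 : ∑ a ∈ Finset.range b, (G a).indicator (fun _ => (1 : ℝ)) ω
        = ((Finset.range b).filter fun a => ∀ j < q, X n (f a j) ω ∉ S).card := by
      rw [Finset.natCast_card_filter]
      exact Finset.sum_congr rfl fun a _ => by simp [Set.indicator_apply, hG_def]
    have h3 : (b : ℝ) ≤
        2 * ((Finset.range b).filter fun a => ∀ j < q, X n (f a j) ω ∉ S).card := by
      exact_mod_cast h1
    change (b : ℝ) / 2 ≤ ∑ a ∈ Finset.range b, (G a).indicator (fun _ => (1 : ℝ)) ω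
    linarith
  have hmarkov := mul_meas_ge_le_integral_of_nonneg (μ := P)
    (f := fun ω => ∑ a ∈ Finset.range b, (G a).indicator (fun _ => (1 : ℝ)) ω)
    (.of_forall fun ω => Finset.sum_nonneg fun a _ =>
      Set.indicator_nonneg (fun _ _ => zero_le_one) ω)
    (integrable_finsetSum _ hint) ((b : ℝ) / 2)
  rw [integral_finsetSum _ hint] at hmarkov
  simp only [integral_indicator_const _ (hG _), smul_eq_mul, mul_one] at hmarkov
  have hsum := Finset.sum_le_sum hGle
  rw [Finset.sum_const, Finset.card_range, nsmul_eq_mul] at hsum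
  have hmono := measureReal_mono (μ := P) hsub
  have := mul_le_mul_of_nonneg_left hmono (half_pos hbpos).le
  refine le_of_mul_le_mul_left ?_ (half_pos hbpos)
  linarith

/-! ### Moments from tails -/

/-- A bounded variable whose tail is at most `M * (exp (-β * t ^ s) + ε)` has its `p`-th moment of
order `β ^ (-p / s) + ε`. -/
lemma integrable_rpow_and_integral_rpow_le {Ω : Type*} [MeasurableSpace Ω] {P : Measure Ω}
    [IsProbabilityMeasure P] {Z : Ω → ℝ} (hZ : Measurable Z) (hZ0 : 0 ≤ Z) {p s β ε M D : ℝ}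
    (hp : 0 < p) (hs : 0 < s) (hβ : 0 < β) (hε : 0 ≤ ε) (hM : 0 ≤ M) (hD : 0 < D)
    (hZD : ∀ᵐ ω ∂P, Z ω ≤ D)
    (htail : ∀ t, 0 < t → t ≤ D → P.real {ω | t < Z ω} ≤ M * (Real.exp (-β * t ^ s) + ε)) :
    Integrable (fun ω => Z ω ^ p) P ∧
      ∫ ω, Z ω ^ p ∂P
        ≤ M * (p * (β ^ (-p / s) * (1 / s) * Real.Gamma (p / s)) + ε * D ^ p) := by
  have hm : Measurable fun ω => Z ω ^ p := hZ.pow_const p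
  refine ⟨?_, ?_⟩
  · refine Integrable.of_bound hm.aestronglyMeasurable (D ^ p) ?_
    filter_upwards [hZD] with ω hω
    rw [Real.norm_of_nonneg (Real.rpow_nonneg (hZ0 ω) p)]
    exact Real.rpow_le_rpow (hZ0 ω) hω hp.le
  have hI1 : IntegrableOn (fun t : ℝ => t ^ (p - 1) * Real.exp (-β * t ^ s)) (Set.Ioi 0) :=
    integrableOn_rpow_mul_exp_neg_mul_rpow (by linarith) hs hβ
  have hv1 : ∫ t in Set.Ioi (0 : ℝ), t ^ (p - 1) * Real.exp (-β * t ^ s)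
      = β ^ (-p / s) * (1 / s) * Real.Gamma (p / s) := by
    rw [integral_rpow_mul_exp_neg_mul_rpow hs (by linarith) hβ, sub_add_cancel]
  have hI2 : IntegrableOn (fun t : ℝ => t ^ (p - 1)) (Set.Ioc 0 D) := by
    rw [← intervalIntegrable_iff_integrableOn_Ioc_of_le hD.le]
    exact intervalIntegral.intervalIntegrable_rpow' (by linarith)
  have hv2 : ∫ t in Set.Ioc (0 : ℝ) D, t ^ (p - 1) = D ^ p / p := by
    rw [← intervalIntegral.integral_of_le hD.le, integral_rpow (.inl (by linarith)),
      sub_add_cancel, Real.zero_rpow hp.ne', sub_zero]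
  set F : ℝ → ℝ := fun t => M * (t ^ (p - 1) * Real.exp (-β * t ^ s))
    + M * ε * (Set.Ioc 0 D).indicator (fun t => t ^ (p - 1)) t with hF
  have hI2' : IntegrableOn ((Set.Ioc 0 D).indicator fun t : ℝ => t ^ (p - 1)) (Set.Ioi 0) :=
    ((integrable_indicator_iff measurableSet_Ioc).2 hI2).integrableOn
  have hFint : IntegrableOn F (Set.Ioi 0) := (hI1.const_mul M).add (hI2'.const_mul (M * ε))
  have hFval : ∫ t in Set.Ioi (0 : ℝ), F t
      = M * (β ^ (-p / s) * (1 / s) * Real.Gamma (p / s)) + M * ε * (D ^ p / p) := by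
    rw [hF, integral_add (hI1.const_mul M) (hI2'.const_mul (M * ε)), integral_const_mul,
      integral_const_mul, hv1, setIntegral_indicator measurableSet_Ioc,
      Set.inter_eq_right.2 Set.Ioc_subset_Ioi_self, hv2]
  have hF0 : ∀ t, 0 < t → 0 ≤ F t := by
    intro t ht
    have : 0 ≤ (Set.Ioc 0 D).indicator (fun t : ℝ => t ^ (p - 1)) t :=
      Set.indicator_nonneg (fun u hu => Real.rpow_nonneg hu.1.le _) t
    have := Real.rpow_nonneg ht.le (p - 1)
    positivity
  rw [integral_eq_lintegral_of_nonneg_ae (.of_forall fun ω => Real.rpow_nonneg (hZ0 ω) p)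
    hm.aestronglyMeasurable,
    lintegral_rpow_eq_lintegral_meas_lt_mul P (.of_forall hZ0) hZ.aemeasurable hp]
  have hle : ∫⁻ t in Set.Ioi 0, P {ω | t < Z ω} * ENNReal.ofReal (t ^ (p - 1))
      ≤ ENNReal.ofReal (∫ t in Set.Ioi 0, F t) := by
    rw [ofReal_integral_eq_lintegral_ofReal hFint
      ((ae_restrict_iff' measurableSet_Ioi).2 (.of_forall hF0))]
    refine setLIntegral_mono' measurableSet_Ioi fun t ht => ?_
    have ht : 0 < t := ht
    have htp : 0 ≤ t ^ (p - 1) := Real.rpow_nonneg ht.le _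
    rcases le_or_gt t D with htD | htD
    · rw [← ofReal_measureReal, ← ENNReal.ofReal_mul measureReal_nonneg]
      refine ENNReal.ofReal_le_ofReal ?_
      rw [hF]
      simp only [Set.indicator_of_mem (show t ∈ Set.Ioc 0 D from ⟨ht, htD⟩)]
      exact (mul_le_mul_of_nonneg_right (htail t ht htD) htp).trans_eq (by ring)
    · have : P {ω | t < Z ω} = 0 := by
        refine measure_mono_null (fun ω hω => ?_) (ae_iff.1 hZD)
        exact not_le.2 (htD.trans hω)
      rw [this, zero_mul]
      exact zero_le
  refine ENNReal.toReal_le_of_le_ofReal ?_ ((mul_le_mul_right hle _).trans ?_)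
  · have := Real.Gamma_pos_of_pos (div_pos hp hs)
    positivity
  · rw [← ENNReal.ofReal_mul hp.le, hFval]
    refine ENNReal.ofReal_le_ofReal (le_of_eq ?_)
    field_simp

/-! ### Boundedness and tail of the radius -/

/-- Every point that satisfies the lower mass condition lies in the support, so almost all
observations are within the diameter of the support. -/
lemma ae_norm_sub_le {Ω : Type*} [MeasurableSpace Ω] {P : Measure Ω} {d : ℕ} {Y : Ω → E d}
    {μ : Measure (E d)} {x : E d} {s c r₀ D : ℝ} (hc : 0 < c) (hr₀ : 0 < r₀) (hY : Measurable Y)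
    (hμ : P.map Y = μ) (hx : LocalLowerMass μ x s c r₀) (hK : CompactSupport μ D) :
    ∀ᵐ ω ∂P, ‖Y ω - x‖ ≤ D := by
  obtain ⟨K, hKc, hKD, hKμ⟩ := hK
  have hxK : x ∈ K := by
    refine hKμ ((Measure.mem_support_iff_forall x).2 fun U hU => ?_)
    obtain ⟨r, hr, hrU⟩ := Metric.nhds_basis_closedBall.mem_iff.1 hU
    have hmin : 0 < min r r₀ := lt_min hr hr₀
    have h1 := hx (min r r₀) hmin (min_le_right _ _)
    have h2 : 0 < μ.real (Metric.closedBall x (min r r₀)) :=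
      (mul_pos hc (Real.rpow_pos_of_pos hmin s)).trans_le h1
    exact (ENNReal.toReal_pos_iff.1 h2).1.trans_le
      (measure_mono ((Metric.closedBall_subset_closedBall (min_le_left _ _)).trans hrU))
  have hae : ∀ᵐ y ∂(P.map Y), y ∈ μ.support := by
    rw [hμ]
    exact Measure.support_mem_ae
  filter_upwards [ae_of_ae_map hY.aemeasurable hae] with ω hω
  rw [← dist_eq_norm]
  exact (Metric.dist_le_diam_of_mem hKc.isBounded (hKμ hω) hxK).trans hKD

lemma ae_radius_le {Ω : Type*} [MeasurableSpace Ω] {P : Measure Ω} {d n : ℕ}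
    {Y : Fin n → Ω → E d} {x : E d} {D : ℝ} (h : ∀ i, ∀ᵐ ω ∂P, ‖Y i ω - x‖ ≤ D) (k : ℕ)
    (hk : 1 ≤ k ∧ k ≤ n) : ∀ᵐ ω ∂P, radius x (fun i => Y i ω) k hk ≤ D := by
  filter_upwards [ae_all_iff.2 h] with ω hω
  exact hω _

/-- The tail of the nearest-neighbor radius inside the range of the lower mass condition. The gap
`A * k` between the indices of a residue class is proportional to `k`. -/
lemma GeometricMixing.measureReal_lt_radius_le {Ω : Type*} [MeasurableSpace Ω] {P : Measure Ω}
    [IsProbabilityMeasure P] {d : ℕ} {X : (n : ℕ) → Fin n → Ω → E d} {γ : ℝ}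
    (h : GeometricMixing P X γ) (hX : ∀ n i, Measurable (X n i)) {μ : Measure (E d)}
    (hμ : ∀ n i, P.map (X n i) = μ) {x : E d} {s c r₀ : ℝ} (hx : LocalLowerMass μ x s c r₀)
    (hc : 0 < c) {n k A : ℕ} (hk : 1 ≤ k ∧ k ≤ n) (hA : 2 ≤ A) (hAk : A * k ≤ n) {t : ℝ}
    (ht : 0 < t) (htr : t ≤ r₀) :
    P.real {ω | t < radius x (fun i => X n i ω) k hk}
      ≤ 2 * (Real.exp (-(c * t ^ s * (n / (2 * (A * k)))))
          + n * Real.exp (-γ * (A * k))) := by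
  classical
  have hb : 1 ≤ A * k := Nat.mul_pos (by omega) hk.1
  have hS : MeasurableSet (Metric.closedBall x t) := Metric.isClosed_closedBall.measurableSet
  have hm : ∀ i, P.real (X n i ⁻¹' Metric.closedBall x t) = μ.real (Metric.closedBall x t) := by
    intro i
    rw [← hμ n i, map_measureReal_apply (hX n i) hS]
  set m := μ.real (Metric.closedBall x t) with hm_def
  have hset : {ω | t < radius x (fun i => X n i ω) k hk}
      = {ω | (Finset.univ.filter fun i => X n i ω ∈ Metric.closedBall x t).card < k} := by
    ext ω
    simp only [Set.mem_ofPred_eq, ← not_le, radius_le_iff]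
  rw [hset]
  refine (h.measureReal_card_lt_le hX (by omega) hb (Nat.mul_le_mul_right k hA)
    (Nat.div_mul_le_self n (A * k)) hS hm).trans ?_
  have hm1 : m ≤ 1 := by
    rw [← hm ⟨0, by omega⟩]
    exact measureReal_le_one
  have hmt : c * t ^ s ≤ m := hx t ht htr
  have hct : 0 ≤ c * t ^ s := by positivity
  have hbR : (0 : ℝ) < A * k := by exact_mod_cast hb
  have hq : (n : ℝ) / (2 * (A * k)) ≤ (n / (A * k) : ℕ) := by
    have h1 : 1 ≤ n / (A * k) := (Nat.one_le_div_iff hb).2 hAk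
    have h2 : n < (n / (A * k) + 1) * (A * k) := by
      rw [mul_comm]
      exact Nat.lt_mul_div_succ n hb
    have h3 : n ≤ (n / (A * k) : ℕ) * (2 * (A * k)) := by nlinarith
    rw [div_le_iff₀ (by positivity)]
    exact_mod_cast h3
  have hpow : (1 - m) ^ (n / (A * k)) ≤ Real.exp (-(c * t ^ s * (n / (2 * (A * k))))) := by
    calc (1 - m) ^ (n / (A * k)) ≤ Real.exp (-m) ^ (n / (A * k)) :=
          pow_le_pow_left₀ (by linarith) (Real.one_sub_le_exp_neg m) _
      _ = Real.exp (-(m * (n / (A * k) : ℕ))) := by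
          rw [← Real.exp_nat_mul]
          ring_nf
      _ ≤ _ := by
          gcongr
  have hqn : ((n / (A * k) : ℕ) : ℝ) ≤ n := by exact_mod_cast Nat.div_le_self _ _
  push_cast at hpow ⊢
  gcongr

end MixingKNN

theorem theorem3 (p s c r₀ γ D K₀ : ℝ) (hp : 0 < p) (hs : 0 < s) (hc : 0 < c) (hr₀ : 0 < r₀)
    (hγ : 0 < γ) (hK₀ : 0 < K₀) :
    ∃ C : ℝ, 0 < C ∧
      ∀ (d : ℕ) (_ : 1 ≤ d) (Ω : Type*) [MeasurableSpace Ω] (P : Measure Ω)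
        [IsProbabilityMeasure P] (X : (n : ℕ) → Fin n → Ω → MixingKNN.E d)
        (μ : Measure (MixingKNN.E d)) (x : MixingKNN.E d) (κ : ℝ),
        (∀ (n : ℕ) (i : Fin n), Measurable (X n i)) →
        (∀ (n : ℕ) (i : Fin n), P.map (X n i) = μ) →
        MixingKNN.GeometricMixing P X γ →
        MixingKNN.LocalLowerMass μ x s c r₀ →
        MixingKNN.CompactSupport μ D →
        0 < κ → κ < c * r₀ ^ s / 8 →
        ∀ (n k : ℕ) (hk : 1 ≤ k ∧ k ≤ n),
          K₀ * Real.log n ≤ k → (k : ℝ) ≤ κ * n →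
          Integrable (fun ω => MixingKNN.radius x (fun i => X n i ω) k hk ^ p) P ∧
          ∫ ω, MixingKNN.radius x (fun i => X n i ω) k hk ^ p ∂P
            ≤ C * ((k : ℝ) / n) ^ (p / s) := by
  open MixingKNN in
  -- The gap `A * k ≥ A * K₀ * log n` makes the mixing error at most `n ^ (-p / s)`.
  obtain ⟨A, hA2, hA⟩ : ∃ A : ℕ, 2 ≤ A ∧ 1 + p / s ≤ γ * A * K₀ := by
    obtain ⟨A, hA⟩ := exists_nat_ge ((1 + p / s) / (γ * K₀))
    refine ⟨A + 2, by omega, ?_⟩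
    rw [div_le_iff₀ (by positivity)] at hA
    have : 0 < γ * K₀ := by positivity
    push_cast
    linarith
  have hA0 : (0 : ℝ) < A := by exact_mod_cast (by omega : 0 < A)
  set D₁ := max D r₀ with hD₁_def
  have hD₁ : 0 < D₁ := hr₀.trans_le (le_max_right _ _)
  have hu1 : r₀ / D₁ ≤ 1 := (div_le_one hD₁).2 (le_max_right _ _)
  have hu0 : 0 < r₀ / D₁ := div_pos hr₀ hD₁
  set β := c * (r₀ / D₁) ^ s / (2 * A) with hβ_def
  have hβ : 0 < β := by positivity
  have hΓ : 0 < Real.Gamma (p / s) := Real.Gamma_pos_of_pos (div_pos hp hs)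
  set C₁ := 2 * (p * (β ^ (-p / s) * (1 / s) * Real.Gamma (p / s)) + D₁ ^ p) with hC₁_def
  have hC₁ : 0 < C₁ := by positivity
  have hC₂ : 0 < (A : ℝ) ^ (p / s) * D₁ ^ p := by positivity
  refine ⟨C₁ + (A : ℝ) ^ (p / s) * D₁ ^ p, by positivity, ?_⟩
  intro d _ Ω _ P _ X μ x κ hX hμ hmix hx hK _ _ n k hk hkn _
  have hn0 : (0 : ℝ) < n := by exact_mod_cast (by omega : 0 < n)
  have hk0 : (0 : ℝ) < k := by exact_mod_cast hk.1
  have hε : 0 < ((k : ℝ) / n) ^ (p / s) := by positivity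
  set Z : Ω → ℝ := fun ω => radius x (fun i => X n i ω) k hk with hZ_def
  have hZm : Measurable Z := measurable_radius x (hX n) k hk
  have hZ0 : 0 ≤ Z := fun ω => radius_nonneg x _ k hk
  have hZD : ∀ᵐ ω ∂P, Z ω ≤ D₁ := ae_radius_le (fun i =>
    (ae_norm_sub_le hc hr₀ (hX n i) (hμ n i) hx hK).mono fun _ h => h.trans (le_max_left _ _)) k hk
  rcases le_or_gt (A * k) n with hAk | hAk
  · have htail : ∀ t, 0 < t → t ≤ D₁ → P.real {ω | t < Z ω}
        ≤ 2 * (Real.exp (-(β * (n / k)) * t ^ s) + ((k : ℝ) / n) ^ (p / s)) := by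
      intro t ht htD
      -- For `t ≤ D₁` the smaller radius `r₀ / D₁ * t` is at most `r₀`.
      have hut : r₀ / D₁ * t ≤ t := mul_le_of_le_one_left ht.le hu1
      have hur : r₀ / D₁ * t ≤ r₀ := by
        calc r₀ / D₁ * t ≤ r₀ / D₁ * D₁ := by gcongr
          _ = r₀ := div_mul_cancel₀ _ hD₁.ne'
      have hsub : {ω | t < Z ω} ⊆ {ω | r₀ / D₁ * t < Z ω} := fun ω hω => hut.trans_lt hω
      refine (measureReal_mono hsub).trans ((hmix.measureReal_lt_radius_le hX hμ hx hc hk hA2 hAk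
        (mul_pos hu0 ht) hur).trans ?_)
      have hexp : c * (r₀ / D₁ * t) ^ s * (n / (2 * (A * k))) = β * (n / k) * t ^ s := by
        rw [hβ_def, Real.mul_rpow hu0.le ht.le]
        field_simp
      have herr : n * Real.exp (-γ * (A * k)) ≤ ((k : ℝ) / n) ^ (p / s) := by
        have hlog : 0 ≤ Real.log n := Real.log_natCast_nonneg n
        have h1 : (1 + p / s) * Real.log n ≤ γ * (A * k) := by
          calc (1 + p / s) * Real.log n ≤ γ * A * K₀ * Real.log n := by gcongr
            _ = γ * A * (K₀ * Real.log n) := by ring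
            _ ≤ γ * A * k := by gcongr
            _ = γ * (A * k) := by ring
        calc n * Real.exp (-γ * (A * k))
            = Real.exp (Real.log n + -γ * (A * k)) := by rw [Real.exp_add, Real.exp_log hn0]
          _ ≤ Real.exp (Real.log (1 / n) * (p / s)) := by
              rw [one_div, Real.log_inv]
              exact Real.exp_le_exp.2 (by linarith)
          _ = (1 / (n : ℝ)) ^ (p / s) := (Real.rpow_def_of_pos (by positivity) _).symm
          _ ≤ ((k : ℝ) / n) ^ (p / s) := by
              gcongr
              exact_mod_cast hk.1
      rw [hexp, ← neg_mul]
      gcongr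
    obtain ⟨hint, hle⟩ := integrable_rpow_and_integral_rpow_le hZm hZ0 hp hs
      (by positivity : 0 < β * (n / k)) hε.le zero_le_two hD₁ hZD htail
    refine ⟨hint, hle.trans ?_⟩
    have hscale : (β * ((n : ℝ) / k)) ^ (-p / s) = β ^ (-p / s) * ((k : ℝ) / n) ^ (p / s) := by
      rw [Real.mul_rpow hβ.le (by positivity), neg_div,
        Real.rpow_neg (by positivity : (0 : ℝ) ≤ n / k), ← Real.inv_rpow (by positivity), inv_div]
    rw [hscale, add_mul]
    calc _ = C₁ * ((k : ℝ) / n) ^ (p / s) := by ring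
      _ ≤ _ := le_add_of_nonneg_right (by positivity)
  · have hb : ∀ᵐ ω ∂P, ‖Z ω ^ p‖ ≤ D₁ ^ p := by
      filter_upwards [hZD] with ω hω
      rw [Real.norm_of_nonneg (Real.rpow_nonneg (hZ0 ω) p)]
      exact Real.rpow_le_rpow (hZ0 ω) hω hp.le
    refine ⟨.of_bound (hZm.pow_const p).aestronglyMeasurable _ hb, ?_⟩
    have h1 : ∫ ω, Z ω ^ p ∂P ≤ D₁ ^ p := by
      simpa using (le_abs_self _).trans (norm_integral_le_of_norm_le_const hb)
    have h2 : (1 : ℝ) ≤ (A : ℝ) ^ (p / s) * ((k : ℝ) / n) ^ (p / s) := by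
      rw [← Real.mul_rpow (by positivity) (by positivity)]
      refine Real.one_le_rpow ?_ (by positivity)
      rw [← mul_div_assoc, one_le_div hn0]
      exact_mod_cast hAk.le
    calc ∫ ω, Z ω ^ p ∂P ≤ D₁ ^ p * 1 := by rwa [mul_one]
      _ ≤ D₁ ^ p * ((A : ℝ) ^ (p / s) * ((k : ℝ) / n) ^ (p / s)) := by gcongr
      _ ≤ C₁ * ((k : ℝ) / n) ^ (p / s)
          + D₁ ^ p * ((A : ℝ) ^ (p / s) * ((k : ℝ) / n) ^ (p / s)) :=
        le_add_of_nonneg_left (by positivity)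
      _ = _ := by ring
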